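/- Let $E=(E^0,E^1,\mathbf r,\mathbf s)$ be a directed graph with at least one vertex (loops and multiple edges are allowed), where $\mathbf s,\mathbf r:E^1\to E^0$ are the source and range maps. The paths in $E$ are the vertices (paths $v$ of length $0$, with $\mathbf s(v)=\mathbf r(v)=v$) and the finite sequences $x=e_1\cdots e_n$ of edges, $n\ge 1$, with $\mathbf r(e_i)=\mathbf s(e_{i+1})$ for $1\le i<n$; in the latter case $\mathbf r(x)=\mathbf r(e_n)$. The out-degree of a vertex $v$ is $|\{e\in E^1 : \mathbf s(e)=v\}|$. The graph inverse semigroup $G(E)$ is the semigroup with zero generated by $E^0\cup E^1\cup\{e^{-1} : e\in E^1\}$ subject to the relations, for all $v,w\in E^0$ and $e,f\in E^1$: $vw=\delta_{v,w}v$; $\mathbf s(e)e=e\mathbf r(e)=e$; $\mathbf r(e)e^{-1}=e^{-1}\mathbf s(e)=e^{-1}$; $e^{-1}f=\delta_{e,f}\mathbf r(e)$ (where $\delta$ is the Kronecker delta). A faithful representation of a semigroup $S$ by partial transformations is an injective semigroup homomorphism from $S$ to the semigroup of all partial functions $X\to X$ on some nonempty set $X$, under composition of relations; its degree is $|X|$.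 **Proposition.** Suppose that $G(E)$ is finite. Then the set of paths $x$ in $E$ such that the out-degree of $\mathbf r(x)$ is at most $1$ is finite, and its cardinality is the minimum possible degree of a faithful representation of $G(E)$ by partial transformations. -/

import Mathlib

universe u v w

/-! ### Directed graphs

A directed graph is a Mathlib quiver on the type `V` of vertices: its edges are the elements
`e : Quiver.Total V`, with source `e.left` and range `e.right`. -/

/-- All paths of the graph, including the vertices as paths of length zero:
triples `⟨source, range, path⟩`. -/
abbrev AllPaths (V : Type u) [Quiver.{v} V] : Type (max u v) :=
  Σ a b : V, Quiver.Path a b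

/-- The range (final vertex) of a path. -/
def AllPaths.range {V : Type u} [Quiver.{v} V] (x : AllPaths V) : V := x.2.1

/-- The out-degree of a vertex: the cardinality of the set of edges with source `a`. -/
noncomputable def outDegree {V : Type u} [Quiver.{v} V] (a : V) : Cardinal.{max u v} :=
  Cardinal.mk {e : Quiver.Total V // e.left = a}

/-! ### The graph inverse semigroup, by generators and relations -/

/-- The generators: the vertices `v`, the edges `e`, and the symbols `e⁻¹`. -/
inductive GISGen (V : Type u) [Quiver.{v} V] : Type (max u v)
  | vertex : V → GISGen V
  | edge : Quiver.Total V → GISGen V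
  | edgeInv : Quiver.Total V → GISGen V

/-- The free semigroup with zero on the generators. -/
abbrev GISFree (V : Type u) [Quiver.{v} V] : Type (max u v) :=
  WithZero (FreeSemigroup (GISGen V))

namespace GISFree

variable {V : Type u} [Quiver.{v} V]

/-- The letter `a`, for a vertex `a`. -/
def vertex (a : V) : GISFree V := (FreeSemigroup.of (GISGen.vertex a) : FreeSemigroup (GISGen V))

/-- The letter `e`, for an edge `e`. -/
def edge (e : Quiver.Total V) : GISFree V :=
  (FreeSemigroup.of (GISGen.edge e) : FreeSemigroup (GISGen V))

/-- The letter `e⁻¹`, for an edge `e`. -/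
def edgeInv (e : Quiver.Total V) : GISFree V :=
  (FreeSemigroup.of (GISGen.edgeInv e) : FreeSemigroup (GISGen V))

end GISFree

open GISFree in
/-- The defining relations (V), (E1), (E2), (CK1). -/
inductive GISRel (V : Type u) [Quiver.{v} V] : GISFree V → GISFree V → Prop
  | v_same (a : V) : GISRel V (vertex a * vertex a) (vertex a)
  | v_ne (a b : V) : a ≠ b → GISRel V (vertex a * vertex b) 0
  | e1_source (e : Quiver.Total V) : GISRel V (vertex e.left * edge e) (edge e)
  | e1_range (e : Quiver.Total V) : GISRel V (edge e * vertex e.right) (edge e)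
  | e2_range (e : Quiver.Total V) : GISRel V (vertex e.right * edgeInv e) (edgeInv e)
  | e2_source (e : Quiver.Total V) : GISRel V (edgeInv e * vertex e.left) (edgeInv e)
  | ck1_same (e : Quiver.Total V) : GISRel V (edgeInv e * edge e) (vertex e.right)
  | ck1_ne (e f : Quiver.Total V) : e ≠ f → GISRel V (edgeInv e * edge f) 0

/-- The graph inverse semigroup `G(E)`: the semigroup with zero generated by the vertices, the
edges and their formal inverses, subject to the relations (V), (E1), (E2), (CK1). -/
def GraphInverseSemigroup (V : Type u) [Quiver.{v} V] : Type (max u v) :=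
  (conGen (GISRel V)).Quotient

instance (V : Type u) [Quiver.{v} V] : Semigroup (GraphInverseSemigroup V) :=
  inferInstanceAs (Semigroup (conGen (GISRel V)).Quotient)

/-! ### Partial transformations -/

/-- The partial functions from `X` to itself. -/
def PartialTransformation (X : Type w) : Type w := X →. X

/-- Composition of partial functions as relations: `f * g` is `f` followed by `g`. -/
instance (X : Type w) : Semigroup (PartialTransformation X) where
  mul f g := PFun.comp (g : X →. X) (f : X →. X)
  mul_assoc f g h := (PFun.comp_assoc (h : X →. X) g f).symm

/-- The degrees of the faithful representations of `S` by partial transformations: the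
cardinalities of the nonempty `X` that admit an injective semigroup homomorphism from `S` to the
partial transformation semigroup on `X`. -/
def faithfulDegrees (S : Type u) [Semigroup S] : Set Cardinal.{w} :=
  {κ | ∃ X : Type w, Nonempty X ∧ Cardinal.mk X = κ ∧
    ∃ φ : S →ₙ* PartialTransformation X, Function.Injective φ}

/-! `G(E)` acts on paths: a vertex fixes the paths that start there, `e` cancels an initial edge
`e`, and `e⁻¹` prepends one. Ranges never change, so for every predicate `P` on vertices the paths
with range in `P` carry a representation, `rep P`.

Upper bound. Every nonzero element has the form `p * q⁻¹` and acts by `p l ↦ q l`; its domain is the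
set of extensions of `p` and its image the set of extensions of `q`. Hence `rep P` is faithful once
every path has an extension with range in `P` and these extensions determine the path
(`rep_injective`). When there are finitely many paths, each extends to one ending in a sink. Let
`x'` properly extend `x`. If the range of `x` has out-degree at most one, `x` itself tells them
apart; otherwise `x` can leave along an edge other than that of `x'` and go on to a sink. So
`outDegree ≤ 1` suffices for `P`.

Lower bound. For such `x`, the idempotents `x y (x y)⁻¹` strictly below `x x⁻¹` have an upper bound
`m` that is still strictly below: `x e (x e)⁻¹` for the only edge `e` leaving the range, or zero at
a sink (`exists_lower_cover`). Under a faithful representation some point is fixed by `x x⁻¹` but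
not by `m`, and distinct `x` need distinct points (`exists_injective_of_faithful`). -/

/-! ### Partial transformations as functional relations -/

namespace PartialTransformation

variable {X : Type*}

/-- The graph of a partial transformation. -/
def Rel (f : PartialTransformation X) (a b : X) : Prop := b ∈ (show X →. X from f) a

theorem ext_rel {f g : PartialTransformation X} (h : ∀ a b, f.Rel a b ↔ g.Rel a b) : f = g :=
  PFun.ext h

theorem rel_mul (f g : PartialTransformation X) (a c : X) :
    (f * g).Rel a c ↔ ∃ b, f.Rel a b ∧ g.Rel b c :=
  Part.mem_bind_iff

theorem Rel.unique {f : PartialTransformation X} {a b c : X} (h : f.Rel a b) (h' : f.Rel a c) :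
    b = c :=
  Part.mem_unique h h'

/-- The partial transformation with a given functional graph. -/
noncomputable def ofRel (R : X → X → Prop) : PartialTransformation X :=
  show X →. X from fun a => ⟨∃ b, R a b, fun h => h.choose⟩

theorem rel_ofRel {R : X → X → Prop} (hR : ∀ a b c, R a b → R a c → b = c) (a b : X) :
    (ofRel R).Rel a b ↔ R a b :=
  ⟨fun ⟨h, e⟩ => by have := h.choose_spec; exact e ▸ this,
    fun h => ⟨⟨b, h⟩, hR a _ _ (Exists.choose_spec (p := R a) ⟨b, h⟩) h⟩⟩

/-- Transport of partial transformations along a bijection. -/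
def transport {Y : Type*} (e : X ≃ Y) : PartialTransformation X →ₙ* PartialTransformation Y where
  toFun f := show Y →. Y from fun y => ((show X →. X from f) (e.symm y)).map e
  map_mul' f g := by
    refine PFun.ext fun a c => ?_
    change _ ↔ c ∈ Part.bind _ _
    simp only [Part.mem_bind_iff, Part.mem_map_iff]
    constructor
    · rintro ⟨d, hd, rfl⟩
      obtain ⟨b, hb, hd⟩ := (rel_mul f g _ _).1 hd
      exact ⟨e b, ⟨b, hb, rfl⟩, d, by rw [e.symm_apply_apply]; exact hd, rfl⟩
    · rintro ⟨_, ⟨b, hb, rfl⟩, d, hd, rfl⟩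
      exact ⟨d, (rel_mul f g _ _).2 ⟨b, hb, by rw [e.symm_apply_apply] at hd; exact hd⟩, rfl⟩

theorem rel_transport {Y : Type*} (e : X ≃ Y) (f : PartialTransformation X) (a b : X) :
    (transport e f).Rel (e a) (e b) ↔ f.Rel a b := by
  change e b ∈ Part.map e ((show X →. X from f) (e.symm (e a))) ↔ b ∈ (show X →. X from f) a
  rw [e.symm_apply_apply, Part.mem_map_iff]
  simp

theorem transport_injective {Y : Type*} (e : X ≃ Y) : Function.Injective (transport e) :=
  fun f g h => ext_rel fun a b => by rw [← rel_transport e, h, rel_transport]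

end PartialTransformation

/-- A lower bound for the degree of a faithful representation: if the semigroup has idempotents
`e i` and elements `m i` with `e i * m i ≠ e i` such that for `i ≠ j` one of `e i * e j`,
`e j * e i` is fixed under right multiplication by `m i`, `m j` respectively, then every faithful
representation acts on a set that contains a copy of the index set. -/
theorem exists_injective_of_faithful {S : Type*} [Semigroup S] {ι : Type*} (e m : ι → S)
    (he : ∀ i, e i * e i = e i) (hm : ∀ i, e i * m i ≠ e i)
    (h : ∀ i j, i ≠ j → e i * e j * m i = e i * e j ∨ e j * e i * m j = e j * e i)
    {X : Type*} (φ : S →ₙ* PartialTransformation X) (hφ : Function.Injective φ) :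
    ∃ t : ι → X, Function.Injective t := by
  -- If `m i` fixed every fixed point of `e i`, it would be the identity on the image of `e i`,
  -- forcing `e i * m i = e i`.
  have key : ∀ i, ∃ t, (φ (e i)).Rel t t ∧ ¬ (φ (m i)).Rel t t := by
    intro i
    by_contra! hc
    -- An idempotent partial map need not be a partial identity, but it fixes its image pointwise.
    have hfix : ∀ p q, (φ (e i)).Rel p q → (φ (e i)).Rel q q := by
      intro p q hpq
      have h1 := hpq
      rw [← he i, map_mul, PartialTransformation.rel_mul] at h1
      obtain ⟨r, hr, hrq⟩ := h1
      rwa [hr.unique hpq] at hrq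
    refine hm i (hφ (PartialTransformation.ext_rel fun p q => ?_))
    rw [map_mul, PartialTransformation.rel_mul]
    constructor
    · rintro ⟨r, hr, hrq⟩
      rwa [hrq.unique (hc r (hfix _ _ hr))]
    · exact fun hpq => ⟨q, hpq, hc q (hfix _ _ hpq)⟩
  choose t ht ht' using key
  -- A common point is fixed by `e i * e j`; if `m i` acts trivially after this product, it fixes
  -- that point as well.
  have aux : ∀ i j, t i = t j → e i * e j * m i ≠ e i * e j := by
    intro i j hij hc
    have h1 : (φ (e i * e j)).Rel (t i) (t i) := by
      rw [map_mul, PartialTransformation.rel_mul]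
      exact ⟨t i, ht i, hij ▸ ht j⟩
    have h2 := h1
    rw [← hc, map_mul, PartialTransformation.rel_mul] at h2
    obtain ⟨r, hr, hr'⟩ := h2
    rw [hr.unique h1] at hr'
    exact ht' i hr'
  refine ⟨t, fun i j hij => ?_⟩
  by_contra hne
  rcases h i j hne with hc | hc
  · exact aux i j hij hc
  · exact aux j i hij.symm hc

/-! ### Paths and their lists of edges -/

/-- The list of edges of a path. -/
def Quiver.Path.edgeList {V : Type u} [Quiver.{v} V] {a : V} :
    {b : V} → Quiver.Path a b → List (Quiver.Total V)
  | _, .nil => []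
  | _, .cons p e => p.edgeList ++ [⟨_, _, e⟩]

namespace AllPaths

variable {V : Type u} [Quiver.{v} V]

/-- The source of a path. -/
def source (x : AllPaths V) : V := x.1

/-- The list of edges of a path. -/
def edges (x : AllPaths V) : List (Quiver.Total V) := x.2.2.edgeList

/-- The path of length zero at a vertex. -/
def single (a : V) : AllPaths V := ⟨a, a, .nil⟩

end AllPaths

namespace Quiver.Path

variable {V : Type u} [Quiver.{v} V]

theorem edgeList_comp {a b c : V} (p : Path a b) (q : Path b c) :
    (p.comp q).edgeList = p.edgeList ++ q.edgeList := by
  induction q with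
  | nil => simp [edgeList]
  | cons q e ih => simp [edgeList, ih]

theorem edgeList_injective {a b c : V} (p : Path a b) (q : Path a c)
    (h : p.edgeList = q.edgeList) : (⟨a, b, p⟩ : AllPaths V) = ⟨a, c, q⟩ := by
  induction p generalizing c with
  | nil => cases q with
    | nil => rfl
    | cons q f => simp [edgeList] at h
  | cons p e ih => cases q with
    | nil => simp [edgeList] at h
    | cons q f =>
      obtain ⟨h1, h2⟩ := List.append_inj' h rfl
      cases ih q h1
      simp only [List.cons.injEq, and_true] at h2
      cases h2
      rfl

theorem exists_of_edgeList_eq_append {a b : V} (p : Path a b) (l₁ l₂ : List (Quiver.Total V))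
    (h : p.edgeList = l₁ ++ l₂) :
    ∃ (c : V) (q : Path a c) (r : Path c b), q.edgeList = l₁ ∧ r.edgeList = l₂ := by
  induction p generalizing l₂ with
  | nil =>
    obtain ⟨rfl, rfl⟩ := List.append_eq_nil_iff.1 h.symm
    exact ⟨a, .nil, .nil, rfl, rfl⟩
  | @cons b c p e ih =>
    rcases List.eq_nil_or_concat l₂ with rfl | ⟨l, f, rfl⟩
    · exact ⟨c, p.cons e, .nil, by simpa using h, rfl⟩
    · simp only [edgeList, List.concat_eq_append, ← List.append_assoc] at h
      obtain ⟨h1, h2⟩ := List.append_inj' h rfl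
      obtain ⟨d, q, r, hq, hr⟩ := ih l h1
      exact ⟨d, q, r.cons e, hq, by simp [edgeList, hr, h2]⟩

end Quiver.Path

namespace AllPaths

variable {V : Type u} [Quiver.{v} V]

/-- The source is needed only because all trivial paths have the same empty list of edges. -/
theorem ext_edges {x y : AllPaths V} (h : x.source = y.source) (h' : x.edges = y.edges) :
    x = y := by
  obtain ⟨a, b, p⟩ := x
  obtain ⟨a', b', q⟩ := y
  cases h
  exact p.edgeList_injective q h'

/-- A path preceded by an edge. -/
theorem exists_cons (e : Quiver.Total V) (x : AllPaths V) (h : x.source = e.right) :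
    ∃ y : AllPaths V, y.source = e.left ∧ y.range = x.range ∧ y.edges = e :: x.edges := by
  obtain ⟨a, b, p⟩ := x
  obtain ⟨c, d, e⟩ := e
  cases h
  exact ⟨⟨c, b, e.toPath.comp p⟩, rfl, rfl, by
    simp [edges, Quiver.Path.edgeList_comp, Quiver.Hom.toPath, Quiver.Path.edgeList]⟩

/-- A path followed by another one. -/
theorem exists_append (x y : AllPaths V) (h : x.range = y.source) :
    ∃ z : AllPaths V, z.source = x.source ∧ z.range = y.range ∧ z.edges = x.edges ++ y.edges := by
  obtain ⟨a, b, p⟩ := x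
  obtain ⟨c, d, q⟩ := y
  cases h
  exact ⟨⟨a, d, p.comp q⟩, rfl, rfl, Quiver.Path.edgeList_comp p q⟩

theorem exists_suffix {x z : AllPaths V} {l : List (Quiver.Total V)}
    (hs : z.source = x.source) (h : z.edges = x.edges ++ l) :
    ∃ y : AllPaths V, y.source = x.range ∧ y.range = z.range ∧ y.edges = l := by
  obtain ⟨a, b, p⟩ := x
  obtain ⟨c, d, q⟩ := z
  cases hs
  obtain ⟨c, q₁, r, h1, h2⟩ := q.exists_of_edgeList_eq_append _ _ h
  cases q₁.edgeList_injective p h1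
  exact ⟨⟨_, _, r⟩, rfl, rfl, h2⟩

theorem left_eq_source_of_edges_eq_cons {x : AllPaths V} {e : Quiver.Total V}
    {l : List (Quiver.Total V)} (h : x.edges = e :: l) : e.left = x.source := by
  obtain ⟨a, b, r⟩ := x
  obtain ⟨c, r₁, r₂, h3, -⟩ := r.exists_of_edgeList_eq_append [e] l h
  cases r₁ with
  | nil => simp [Quiver.Path.edgeList] at h3
  | cons r f =>
    obtain ⟨h4, h5⟩ := List.append_inj' (s₂ := []) h3 rfl
    cases r with
    | cons => simp [Quiver.Path.edgeList] at h4
    | nil =>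
      simp only [List.cons.injEq, and_true] at h5
      rw [← h5]
      rfl

/-- The path `y` has the initial segment `x`. -/
def Extends (y x : AllPaths V) : Prop := y.source = x.source ∧ x.edges <+: y.edges

theorem Extends.refl (x : AllPaths V) : x.Extends x := ⟨rfl, List.prefix_rfl⟩

theorem Extends.trans {x y z : AllPaths V} (h : z.Extends y) (h' : y.Extends x) : z.Extends x :=
  ⟨h.1.trans h'.1, h'.2.trans h.2⟩

theorem Extends.antisymm {x y : AllPaths V} (h : y.Extends x) (h' : x.Extends y) : x = y :=
  ext_edges h'.1 (h.2.eq_of_length_le h'.2.length_le)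

theorem Extends.total {x y z : AllPaths V} (h : z.Extends x) (h' : z.Extends y) :
    y.Extends x ∨ x.Extends y :=
  (List.prefix_or_prefix_of_prefix h.2 h'.2).imp (⟨h'.1.symm.trans h.1, ·⟩)
    (⟨h.1.symm.trans h'.1, ·⟩)

/-- A path followed by an edge. -/
theorem exists_snoc (x : AllPaths V) (e : Quiver.Total V) (h : e.left = x.range) :
    ∃ y : AllPaths V, y.source = x.source ∧ y.range = e.right ∧ y.edges = x.edges ++ [e] := by
  obtain ⟨a, b, p⟩ := x
  obtain ⟨c, d, e⟩ := e
  cases h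
  exact ⟨⟨a, d, p.cons e⟩, rfl, rfl, rfl⟩

theorem Extends.exists_edge {x y : AllPaths V} (h : y.Extends x) (hne : x ≠ y) :
    ∃ (e : Quiver.Total V) (l : List (Quiver.Total V)),
      e.left = x.range ∧ y.edges = x.edges ++ e :: l := by
  obtain ⟨hs, l, hl⟩ := h
  cases l with
  | nil => exact (hne (ext_edges hs.symm (by simpa using hl))).elim
  | cons e l =>
    obtain ⟨z, hz, -, hz'⟩ := exists_suffix hs hl.symm
    exact ⟨e, l, (left_eq_source_of_edges_eq_cons hz').trans hz, hl.symm⟩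

/-- If there are finitely many paths, each of them extends to a path that ends in a sink. -/
theorem exists_extends_sink [Finite (AllPaths V)] (x : AllPaths V) :
    ∃ y : AllPaths V, y.Extends x ∧ ∀ e : Quiver.Total V, e.left ≠ y.range := by
  obtain ⟨y, hy, hmax⟩ := Set.exists_max_image {y : AllPaths V | y.Extends x}
    (fun y => y.edges.length) (Set.toFinite _) ⟨x, .refl x⟩
  refine ⟨y, hy, fun e he => ?_⟩
  obtain ⟨z, h1, -, h2⟩ := y.exists_snoc e he
  have := hmax z (Extends.trans ⟨h1, h2 ▸ List.prefix_append _ _⟩ hy)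
  simp [h2] at this

end AllPaths

namespace GraphInverseSemigroup

variable {V : Type u} [Quiver.{v} V]

/-! ### The representation by cancelling and adding initial segments of paths -/

/-- The relations by which the generators act on paths. -/
def GenRel : GISGen V → AllPaths V → AllPaths V → Prop
  | .vertex a, x, y => x = y ∧ x.source = a
  | .edge e, x, y => x.source = e.left ∧ y.source = e.right ∧ x.edges = e :: y.edges
  | .edgeInv e, x, y => x.source = e.right ∧ y.source = e.left ∧ y.edges = e :: x.edges

theorem GenRel.unique {g : GISGen V} {x y z : AllPaths V} (h : GenRel g x y) (h' : GenRel g x z) :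
    y = z := by
  cases g with
  | vertex a => exact h.1.symm.trans h'.1
  | edge e =>
    exact AllPaths.ext_edges (h.2.1.trans h'.2.1.symm)
      (List.cons.inj (h.2.2.symm.trans h'.2.2)).2
  | edgeInv e => exact AllPaths.ext_edges (h.2.1.trans h'.2.1.symm) (h.2.2.trans h'.2.2.symm)

variable (P : V → Prop)

/-- The action of the free semigroup with zero on the paths with range in `P`. -/
noncomputable def freeRep : GISFree V →ₙ* PartialTransformation {x : AllPaths V // P x.range} where
  toFun s := s.elim (.ofRel fun _ _ => False)
    (FreeSemigroup.lift fun g => .ofRel fun x y => GenRel g x.1 y.1)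
  map_mul' s t := by
    have h0 (x y) : ¬ (PartialTransformation.ofRel
        (X := {x : AllPaths V // P x.range}) fun _ _ => False).Rel x y := fun h =>
      (PartialTransformation.rel_ofRel (by simp) x y).1 h
    induction s using WithZero.recZeroCoe with
    | zero =>
      refine PartialTransformation.ext_rel fun x y => ?_
      rw [PartialTransformation.rel_mul, zero_mul]
      exact ⟨fun h => (h0 _ _ h).elim, fun ⟨_, h, _⟩ => (h0 _ _ h).elim⟩
    | coe s => induction t using WithZero.recZeroCoe with
      | zero =>
        refine PartialTransformation.ext_rel fun x y => ?_
        rw [PartialTransformation.rel_mul, mul_zero]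
        exact ⟨fun h => (h0 _ _ h).elim, fun ⟨_, _, h⟩ => (h0 _ _ h).elim⟩
      | coe t => exact map_mul (FreeSemigroup.lift _) s t

theorem freeRep_zero (x y) : ¬ (freeRep (V := V) P 0).Rel x y := fun h =>
  (PartialTransformation.rel_ofRel (by simp) x y).1 h

theorem freeRep_gen (g : GISGen V) (x y) :
    (freeRep P (FreeSemigroup.of g : FreeSemigroup (GISGen V))).Rel x y ↔ GenRel g x.1 y.1 :=
  PartialTransformation.rel_ofRel (fun _ _ _ h h' => Subtype.ext (h.unique h')) x y

theorem freeRep_vertex (a : V) (x y) :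
    (freeRep P (GISFree.vertex a)).Rel x y ↔ x = y ∧ x.1.source = a :=
  (freeRep_gen P _ x y).trans (by simp [GenRel, Subtype.ext_iff])

theorem freeRep_edge (e : Quiver.Total V) (x y) :
    (freeRep P (GISFree.edge e)).Rel x y ↔
      x.1.source = e.left ∧ y.1.source = e.right ∧ x.1.edges = e :: y.1.edges :=
  freeRep_gen P _ x y

theorem freeRep_edgeInv (e : Quiver.Total V) (x y) :
    (freeRep P (GISFree.edgeInv e)).Rel x y ↔
      x.1.source = e.right ∧ y.1.source = e.left ∧ y.1.edges = e :: x.1.edges :=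
  freeRep_gen P _ x y

/-- Restricting to ranges in `P` is harmless: the intermediate path needed for `e⁻¹ e` is `e x`,
which has the range of `x`. -/
theorem freeRep_eq_of_gisRel {s t : GISFree V} (h : GISRel V s t) :
    freeRep P s = freeRep P t := by
  refine PartialTransformation.ext_rel fun x y => ?_
  cases h with
  | v_same a =>
    simp only [map_mul, PartialTransformation.rel_mul, freeRep_vertex]
    constructor
    · rintro ⟨_, ⟨rfl, h⟩, rfl, -⟩
      exact ⟨rfl, h⟩
    · rintro ⟨rfl, h⟩
      exact ⟨x, ⟨rfl, h⟩, rfl, h⟩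
  | v_ne a b hab =>
    simp only [map_mul, PartialTransformation.rel_mul, freeRep_vertex, freeRep_zero, iff_false]
    rintro ⟨_, ⟨rfl, h⟩, rfl, h'⟩
    exact hab (h.symm.trans h')
  | e1_source e =>
    simp only [map_mul, PartialTransformation.rel_mul, freeRep_vertex, freeRep_edge]
    constructor
    · rintro ⟨_, ⟨rfl, -⟩, h⟩
      exact h
    · exact fun h => ⟨x, ⟨rfl, h.1⟩, h⟩
  | e1_range e =>
    simp only [map_mul, PartialTransformation.rel_mul, freeRep_vertex, freeRep_edge]
    constructor
    · rintro ⟨_, h, rfl, -⟩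
      exact h
    · exact fun h => ⟨y, h, rfl, h.2.1⟩
  | e2_range e =>
    simp only [map_mul, PartialTransformation.rel_mul, freeRep_vertex, freeRep_edgeInv]
    constructor
    · rintro ⟨_, ⟨rfl, -⟩, h⟩
      exact h
    · exact fun h => ⟨x, ⟨rfl, h.1⟩, h⟩
  | e2_source e =>
    simp only [map_mul, PartialTransformation.rel_mul, freeRep_vertex, freeRep_edgeInv]
    constructor
    · rintro ⟨_, h, rfl, -⟩
      exact h
    · exact fun h => ⟨y, h, rfl, h.2.1⟩
  | ck1_same e =>
    simp only [map_mul, PartialTransformation.rel_mul, freeRep_vertex, freeRep_edge,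
      freeRep_edgeInv]
    constructor
    · rintro ⟨z, ⟨h1, -, h2⟩, -, h3, h4⟩
      exact ⟨Subtype.ext (AllPaths.ext_edges (h1.trans h3.symm)
        (List.cons.inj (h2.symm.trans h4)).2), h1⟩
    · rintro ⟨rfl, h⟩
      obtain ⟨z, h1, h2, h3⟩ := AllPaths.exists_cons e x.1 h
      exact ⟨⟨z, h2 ▸ x.2⟩, ⟨h, h1, h3⟩, h1, h, h3⟩
  | ck1_ne e f hef =>
    simp only [map_mul, PartialTransformation.rel_mul, freeRep_edge, freeRep_edgeInv,
      freeRep_zero, iff_false]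
    rintro ⟨z, ⟨-, -, h2⟩, -, -, h4⟩
    exact hef (List.cons.inj (h2.symm.trans h4)).1

/-- The class of an element of the free semigroup with zero. -/
def mk : GISFree V →ₙ* GraphInverseSemigroup V := (conGen (GISRel V)).mkMulHom

theorem mk_surjective : Function.Surjective (mk (V := V)) := fun s =>
  Con.induction_on (c := conGen (GISRel V)) (C := fun s => ∃ t, mk t = s) s fun x => ⟨x, rfl⟩

theorem mk_eq_of_gisRel {s t : GISFree V} (h : GISRel V s t) : mk s = mk t :=
  (Con.eq _).2 (Con.le_conGen _ _ h)

/-- The action of the graph inverse semigroup on the paths with range in `P`. -/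
noncomputable def rep :
    GraphInverseSemigroup V →ₙ* PartialTransformation {x : AllPaths V // P x.range} where
  toFun s := Con.liftOn (c := conGen (GISRel V)) s (freeRep P) fun _ _ h =>
    (Con.conGen_le (c := Con.ker (freeRep P))).2 (fun _ _ h => freeRep_eq_of_gisRel P h) h
  map_mul' s t := by
    obtain ⟨s, rfl⟩ := mk_surjective s
    obtain ⟨t, rfl⟩ := mk_surjective t
    exact map_mul (freeRep P) s t

theorem rep_mk (s : GISFree V) : rep P (mk s) = freeRep P s := rfl

/-! ### Normal forms -/

theorem mk_zero_mul (s : GraphInverseSemigroup V) : mk 0 * s = mk 0 := by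
  obtain ⟨s, rfl⟩ := mk_surjective s
  rw [← map_mul, zero_mul]

theorem mul_mk_zero (s : GraphInverseSemigroup V) : s * mk 0 = mk 0 := by
  obtain ⟨s, rfl⟩ := mk_surjective s
  rw [← map_mul, mul_zero]

/-- The element of the graph inverse semigroup given by a path. -/
def ofPath {a : V} : {b : V} → Quiver.Path a b → GraphInverseSemigroup V
  | _, .nil => mk (GISFree.vertex a)
  | _, .cons p e => ofPath p * mk (GISFree.edge ⟨_, _, e⟩)

/-- The inverse of the element of the graph inverse semigroup given by a path. -/
def ofPathInv {a : V} : {b : V} → Quiver.Path a b → GraphInverseSemigroup V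
  | _, .nil => mk (GISFree.vertex a)
  | _, .cons p e => mk (GISFree.edgeInv ⟨_, _, e⟩) * ofPathInv p

theorem rep_ofPath {a b : V} (p : Quiver.Path a b) (x y) :
    (rep P (ofPath p)).Rel x y ↔
      x.1.source = a ∧ y.1.source = b ∧ x.1.edges = p.edgeList ++ y.1.edges := by
  induction p generalizing x y with
  | nil =>
    rw [ofPath, rep_mk, freeRep_vertex, Quiver.Path.edgeList]
    constructor
    · rintro ⟨rfl, h⟩
      exact ⟨h, h, rfl⟩
    · rintro ⟨h1, h2, h3⟩
      exact ⟨Subtype.ext (AllPaths.ext_edges (h1.trans h2.symm) h3), h1⟩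
  | cons p e ih =>
    simp only [ofPath, map_mul, PartialTransformation.rel_mul, rep_mk, freeRep_edge, ih,
      Quiver.Path.edgeList, List.append_assoc]
    constructor
    · rintro ⟨z, ⟨h1, h2, h3⟩, h4, h5, h6⟩
      exact ⟨h1, h5, by simp [h3, h6]⟩
    · rintro ⟨h1, h2, h3⟩
      obtain ⟨z, h4, h5, h6⟩ := AllPaths.exists_cons ⟨_, _, e⟩ y.1 h2
      exact ⟨⟨z, h5 ▸ y.2⟩, ⟨h1, h4, by simp [h3, h6]⟩, h4, h2, h6⟩

theorem rep_ofPathInv {a b : V} (p : Quiver.Path a b) (x y) :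
    (rep P (ofPathInv p)).Rel x y ↔
      y.1.source = a ∧ x.1.source = b ∧ y.1.edges = p.edgeList ++ x.1.edges := by
  induction p generalizing x y with
  | nil =>
    rw [ofPathInv, rep_mk, freeRep_vertex, Quiver.Path.edgeList]
    constructor
    · rintro ⟨rfl, h⟩
      exact ⟨h, h, rfl⟩
    · rintro ⟨h1, h2, h3⟩
      exact ⟨Subtype.ext (AllPaths.ext_edges (h2.trans h1.symm) h3.symm), h2⟩
  | cons p e ih =>
    simp only [ofPathInv, map_mul, PartialTransformation.rel_mul, rep_mk, freeRep_edgeInv, ih,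
      Quiver.Path.edgeList, List.append_assoc]
    constructor
    · rintro ⟨z, ⟨h4, h5, h6⟩, h1, h2, h3⟩
      exact ⟨h1, h4, by simp [h3, h6]⟩
    · rintro ⟨h1, h2, h3⟩
      obtain ⟨z, h4, h5, h6⟩ := AllPaths.exists_cons ⟨_, _, e⟩ x.1 h2
      exact ⟨⟨z, h5 ▸ x.2⟩, ⟨h2, h4, h6⟩, h1, h4, by simp [h3, h6]⟩

theorem ofPathInv_comp {a b c : V} (p : Quiver.Path a b) (q : Quiver.Path b c) :
    ofPathInv (p.comp q) = ofPathInv q * ofPathInv p := by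
  induction q with
  | nil =>
    cases p with
    | nil => exact (mk_eq_of_gisRel (.v_same _)).symm
    | cons p e =>
      simp only [Quiver.Path.comp_nil, ofPathInv, ← mul_assoc]
      rw [← map_mul, mk_eq_of_gisRel (.e2_range ⟨_, _, e⟩)]
  | cons q e ih => simp only [Quiver.Path.comp_cons, ofPathInv, ih, mul_assoc]

theorem ofPathInv_mul_vertex {a b : V} (p : Quiver.Path a b) :
    ofPathInv p * mk (GISFree.vertex a) = ofPathInv p := by
  simpa [ofPathInv] using (ofPathInv_comp (.nil : Quiver.Path a a) p).symm

theorem ofPathInv_mul_vertex_of_ne {a b c : V} (p : Quiver.Path a b) (h : a ≠ c) :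
    ofPathInv p * mk (GISFree.vertex c) = mk 0 := by
  rw [← ofPathInv_mul_vertex, mul_assoc, ← map_mul, mk_eq_of_gisRel (.v_ne a c h), mul_mk_zero]

theorem ofPathInv_mul_edgeInv {a b c : V} (p : Quiver.Path a b) (e : c ⟶ a) :
    ofPathInv p * mk (GISFree.edgeInv ⟨c, a, e⟩) = ofPathInv (e.toPath.comp p) := by
  rw [ofPathInv_comp, Quiver.Hom.toPath, ofPathInv, ofPathInv, ← map_mul,
    mk_eq_of_gisRel (.e2_source ⟨c, a, e⟩)]

theorem ofPathInv_mul_edgeInv_of_ne {a b : V} (p : Quiver.Path a b) (e : Quiver.Total V)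
    (h : a ≠ e.right) : ofPathInv p * mk (GISFree.edgeInv e) = mk 0 := by
  rw [← mk_eq_of_gisRel (.e2_range e), map_mul, ← mul_assoc, ofPathInv_mul_vertex_of_ne p h,
    mk_zero_mul]

/-- Since `(p f)⁻¹ e = f⁻¹ (p⁻¹ e)`, the edge meets the first edge of the path first: it either
cancels or gives zero. The last alternative arises only from a trivial path. -/
theorem ofPathInv_mul_edge {a b : V} (p : Quiver.Path a b) (e : Quiver.Total V) :
    ofPathInv p * mk (GISFree.edge e) = mk 0 ∨
      (∃ q : Quiver.Path e.right b, ofPathInv p * mk (GISFree.edge e) = ofPathInv q) ∨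
      (b = e.left ∧ ofPathInv p * mk (GISFree.edge e) = mk (GISFree.edge e)) := by
  induction p with
  | nil =>
    by_cases h : a = e.left
    · subst h
      exact .inr (.inr ⟨rfl, by rw [ofPathInv, ← map_mul, mk_eq_of_gisRel (.e1_source e)]⟩)
    · refine .inl ?_
      rw [← mk_eq_of_gisRel (.e1_source e), map_mul, ← mul_assoc,
        ofPathInv_mul_vertex_of_ne _ h, mk_zero_mul]
  | @cons b c p f ih =>
    rw [ofPathInv, mul_assoc]
    rcases ih with h | ⟨q, h⟩ | ⟨hb, h⟩
    · exact .inl (by rw [h, mul_mk_zero])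
    · exact .inr (.inl ⟨q.cons f, by rw [h, ofPathInv]⟩)
    · rw [h, ← map_mul]
      by_cases hf : (⟨b, c, f⟩ : Quiver.Total V) = e
      · subst hf
        exact .inr (.inl ⟨.nil, mk_eq_of_gisRel (.ck1_same _)⟩)
      · exact .inl (mk_eq_of_gisRel (.ck1_ne _ _ hf))

theorem ofPath_mul_vertex {a b : V} (p : Quiver.Path a b) :
    ofPath p * mk (GISFree.vertex b) = ofPath p := by
  cases p with
  | nil => exact mk_eq_of_gisRel (.v_same _)
  | cons p e => rw [ofPath, mul_assoc, ← map_mul, mk_eq_of_gisRel (.e1_range ⟨_, _, e⟩)]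

/-- The zero element and the elements `p * q⁻¹` for paths `p`, `q` with a common range. -/
def IsNormal (s : GraphInverseSemigroup V) : Prop :=
  s = mk 0 ∨ ∃ (a b c : V) (p : Quiver.Path a c) (q : Quiver.Path b c),
    s = ofPath p * ofPathInv q

/-- Nonzero words grow by appending letters, so stability under right multiplication by generators
yields normal forms for all elements. Their uniqueness is not needed here. -/
theorem IsNormal.mul_gen {s : GraphInverseSemigroup V} (hs : IsNormal s) (g : GISGen V) :
    IsNormal (s * mk (FreeSemigroup.of g : FreeSemigroup (GISGen V))) := by
  rcases hs with rfl | ⟨a, b, c, p, q, rfl⟩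
  · exact .inl (mk_zero_mul _)
  rw [mul_assoc]
  cases g with
  | vertex d =>
    change IsNormal (_ * (_ * mk (GISFree.vertex d)))
    by_cases h : b = d
    · subst h
      exact .inr ⟨a, b, c, p, q, by rw [ofPathInv_mul_vertex]⟩
    · exact .inl (by rw [ofPathInv_mul_vertex_of_ne _ h, mul_mk_zero])
  | edge e =>
    change IsNormal (_ * (_ * mk (GISFree.edge e)))
    rcases ofPathInv_mul_edge q e with h | ⟨r, h⟩ | ⟨h, h'⟩
    · exact .inl (by rw [h, mul_mk_zero])
    · exact .inr ⟨a, _, c, p, r, by rw [h]⟩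
    · subst h
      refine .inr ⟨a, _, _, p.cons e.hom, .nil, ?_⟩
      rw [h', ← ofPath_mul_vertex (p.cons e.hom)]
      rw [ofPathInv, mul_assoc, ← map_mul, mk_eq_of_gisRel (.v_same _), ofPath_mul_vertex, ofPath]
  | edgeInv e =>
    change IsNormal (_ * (_ * mk (GISFree.edgeInv e)))
    by_cases h : b = e.right
    · subst h
      exact .inr ⟨a, _, c, p, e.hom.toPath.comp q, by rw [← ofPathInv_mul_edgeInv]⟩
    · exact .inl (by rw [ofPathInv_mul_edgeInv_of_ne _ _ h, mul_mk_zero])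

theorem isNormal_gen (g : GISGen V) :
    IsNormal (mk (V := V) (FreeSemigroup.of g : FreeSemigroup (GISGen V))) := by
  have key (a : V) : IsNormal (mk (GISFree.vertex a)) :=
    .inr ⟨a, a, a, .nil, .nil, (mk_eq_of_gisRel (.v_same a)).symm⟩
  cases g with
  | vertex a => exact key a
  | edge e =>
    have := (key e.left).mul_gen (.edge e)
    rw [← map_mul] at this
    exact mk_eq_of_gisRel (.e1_source e) ▸ this
  | edgeInv e =>
    have := (key e.right).mul_gen (.edgeInv e)
    rw [← map_mul] at this
    exact mk_eq_of_gisRel (.e2_range e) ▸ this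

theorem isNormal (s : GraphInverseSemigroup V) : IsNormal s := by
  obtain ⟨s, rfl⟩ := mk_surjective s
  induction s using WithZero.recZeroCoe with
  | zero => exact .inl rfl
  | coe s =>
    obtain ⟨g, l⟩ := s
    induction l using List.reverseRecOn with
    | nil => exact isNormal_gen g
    | append_singleton l g' ih =>
      have := ih.mul_gen g'
      rwa [← map_mul] at this

/-! ### Faithfulness of the action -/

/-- The element replaces the initial segment `p` by `q`; the intermediate point is the remaining
suffix. -/
theorem rep_ofPath_mul_ofPathInv {a b c : V} (p : Quiver.Path a c) (q : Quiver.Path b c) (x y) :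
    (rep P (ofPath p * ofPathInv q)).Rel x y ↔ x.1.source = a ∧ y.1.source = b ∧
      ∃ l, x.1.edges = p.edgeList ++ l ∧ y.1.edges = q.edgeList ++ l := by
  simp only [map_mul, PartialTransformation.rel_mul, rep_ofPath, rep_ofPathInv]
  constructor
  · rintro ⟨z, ⟨h1, -, h2⟩, h3, -, h4⟩
    exact ⟨h1, h3, _, h2, h4⟩
  · rintro ⟨h1, h2, l, h3, h4⟩
    obtain ⟨z, h5, h6, h7⟩ := AllPaths.exists_suffix (x := ⟨a, c, p⟩) h1 h3
    exact ⟨⟨z, h6 ▸ x.2⟩, ⟨h1, h5, h7 ▸ h3⟩, h2, h5, h7 ▸ h4⟩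

theorem exists_rep_left_iff {a b c : V} (p : Quiver.Path a c) (q : Quiver.Path b c) (x) :
    (∃ y, (rep P (ofPath p * ofPathInv q)).Rel x y) ↔ x.1.Extends ⟨a, c, p⟩ := by
  simp only [rep_ofPath_mul_ofPathInv]
  constructor
  · rintro ⟨y, h1, -, l, h2, -⟩
    exact ⟨h1, l, h2.symm⟩
  · rintro ⟨h1, l, h2⟩
    obtain ⟨z, h3, h4, h5⟩ := AllPaths.exists_suffix h1 h2.symm
    obtain ⟨y, h6, h7, h8⟩ := AllPaths.exists_append ⟨b, c, q⟩ z h3.symm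
    exact ⟨⟨y, (h7.trans h4) ▸ x.2⟩, h1, h6, l, h2.symm, h5 ▸ h8⟩

theorem exists_rep_right_iff {a b c : V} (p : Quiver.Path a c) (q : Quiver.Path b c) (y) :
    (∃ x, (rep P (ofPath p * ofPathInv q)).Rel x y) ↔ y.1.Extends ⟨b, c, q⟩ := by
  rw [← exists_rep_left_iff P q p]
  simp only [rep_ofPath_mul_ofPathInv]
  exact exists_congr fun x =>
    ⟨fun ⟨h1, h2, l, h3, h4⟩ => ⟨h2, h1, l, h4, h3⟩, fun ⟨h1, h2, l, h3, h4⟩ => ⟨h2, h1, l, h4, h3⟩⟩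

/-- If the paths are separated by their extensions with range in `P`, and each of them has such an
extension, then the action on the paths with range in `P` is faithful. -/
theorem rep_injective (hne : ∀ x : AllPaths V, ∃ y : AllPaths V, P y.range ∧ y.Extends x)
    (hsep : ∀ x x' : AllPaths V,
      (∀ y : AllPaths V, P y.range → (y.Extends x ↔ y.Extends x')) → x = x') :
    Function.Injective (rep (V := V) P) := by
  have hzero {a b c : V} (p : Quiver.Path a c) (q : Quiver.Path b c)
      (h : rep P (mk 0) = rep P (ofPath p * ofPathInv q)) : False := by
    obtain ⟨y, hy, hy'⟩ := hne ⟨a, c, p⟩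
    obtain ⟨z, hz⟩ := (exists_rep_left_iff P p q ⟨y, hy⟩).2 hy'
    exact freeRep_zero P _ _ (h ▸ hz)
  intro s t h
  rcases isNormal s with rfl | ⟨a, b, c, p, q, rfl⟩ <;>
    rcases isNormal t with rfl | ⟨a', b', c', p', q', rfl⟩
  · rfl
  · exact (hzero _ _ h).elim
  · exact (hzero _ _ h.symm).elim
  -- Equal domains give equal first paths, and equal images give equal second ones.
  · cases hsep ⟨a, c, p⟩ ⟨a', c', p'⟩ fun y hy => by
      rw [← exists_rep_left_iff P p q ⟨y, hy⟩, h, exists_rep_left_iff]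
    cases hsep ⟨b, c, q⟩ ⟨b', c, q'⟩ fun y hy => by
      rw [← exists_rep_right_iff P p q ⟨y, hy⟩, h, exists_rep_right_iff]
    rfl

/-- A path is the shortest of its own extensions. Identities in `G(E)` can thus be checked on
partial maps of paths. -/
theorem rep_true_injective : Function.Injective (rep (V := V) fun _ => True) :=
  rep_injective _ (fun x => ⟨x, trivial, .refl x⟩) fun x x' h =>
    ((h x' trivial).2 (.refl x')).antisymm ((h x trivial).1 (.refl x))

theorem rep_outDegree_le_one_injective [Finite (AllPaths V)] :
    Function.Injective (rep (V := V) (outDegree · ≤ 1)) := by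
  have hne (x : AllPaths V) : ∃ y : AllPaths V, outDegree y.range ≤ 1 ∧ y.Extends x := by
    obtain ⟨y, hy, hy'⟩ := x.exists_extends_sink
    exact ⟨y, Cardinal.le_one_iff_subsingleton.2 ⟨fun e => (hy' e.1 e.2).elim⟩, hy⟩
  refine rep_injective _ hne ?_
  have key (x x' : AllPaths V) (hx : x'.Extends x)
      (h : ∀ y : AllPaths V, outDegree y.range ≤ 1 → (y.Extends x ↔ y.Extends x')) : x = x' := by
    by_contra hxx
    by_cases hd : outDegree x.range ≤ 1
    · exact hxx (hx.antisymm ((h x hd).1 (.refl x)))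
    obtain ⟨e, l, he, hl⟩ := hx.exists_edge hxx
    rw [outDegree, Cardinal.le_one_iff_subsingleton, not_subsingleton_iff_nontrivial] at hd
    -- A second edge `f` out of the range of `x`; a path through `x f` extends `x` but not `x'`,
    -- which continues with `e`.
    obtain ⟨⟨f, hf⟩, hfe⟩ := exists_ne (⟨e, he⟩ : {e : Quiver.Total V // e.left = x.range})
    obtain ⟨z, h1, -, h2⟩ := x.exists_snoc f hf
    obtain ⟨y, hy, hyz⟩ := hne z
    obtain ⟨k, hk⟩ := ((h y hy).1 (hyz.trans ⟨h1, h2 ▸ List.prefix_append _ _⟩)).2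
    obtain ⟨k', hk'⟩ := hyz.2
    rw [← hk', h2, hl] at hk
    simp only [List.append_assoc, List.append_cancel_left_eq, List.cons_append,
      List.cons.injEq] at hk
    exact hfe (Subtype.ext hk.1.symm)
  intro x x' h
  -- An extension `y` of `x` also extends `x'`, so the two are comparable and `key` applies.
  obtain ⟨y, hy, hyx⟩ := hne x
  rcases hyx.total ((h y hy).1 hyx) with hx | hx
  · exact key x x' hx h
  · exact (key x' x hx fun y hy => (h y hy).symm).symm

/-! ### Idempotents -/

/-- The idempotent `x * x⁻¹` of a path `x`. -/
def idem (x : AllPaths V) : GraphInverseSemigroup V := ofPath x.2.2 * ofPathInv x.2.2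

theorem rep_idem (x : AllPaths V) (y z) :
    (rep P (idem x)).Rel y z ↔ y = z ∧ y.1.Extends x := by
  rw [idem, rep_ofPath_mul_ofPathInv]
  constructor
  · rintro ⟨h1, h2, l, h3, h4⟩
    exact ⟨Subtype.ext (AllPaths.ext_edges (h1.trans h2.symm) (h3.trans h4.symm)),
      h1, l, h3.symm⟩
  · rintro ⟨rfl, h1, l, h2⟩
    exact ⟨h1, h1, l, h2.symm, h2.symm⟩

/-- This is how finiteness of `G(E)` bounds the number of paths. -/
theorem idem_injective : Function.Injective (idem (V := V)) := by
  intro x y h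
  have key (z : AllPaths V) : z.Extends x ↔ z.Extends y := by
    have := rep_idem (fun _ => True) x ⟨z, trivial⟩ ⟨z, trivial⟩
    rw [h, rep_idem] at this
    simpa using this.symm
  exact ((key y).2 (.refl y)).antisymm ((key x).1 (.refl x))

theorem idem_mul_self (x : AllPaths V) : idem x * idem x = idem x := by
  refine rep_true_injective (PartialTransformation.ext_rel fun y z => ?_)
  simp only [map_mul, PartialTransformation.rel_mul, rep_idem]
  exact ⟨fun ⟨_, ⟨h, h'⟩, h'', _⟩ => ⟨h.trans h'', h'⟩, fun ⟨h, h'⟩ => ⟨y, ⟨rfl, h'⟩, h, h'⟩⟩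

/-- Below the idempotent of a path whose range has out-degree at most one there is a largest
strictly smaller one. -/
theorem exists_lower_cover (x : AllPaths V) (hx : outDegree x.range ≤ 1) :
    ∃ m, idem x * m ≠ idem x ∧
      ∀ y : AllPaths V, ¬ x.Extends y → idem x * idem y * m = idem x * idem y := by
  rw [outDegree, Cardinal.le_one_iff_subsingleton] at hx
  have hxx : (rep (fun _ => True) (idem x)).Rel ⟨x, trivial⟩ ⟨x, trivial⟩ :=
    (rep_idem _ _ _ _).2 ⟨rfl, .refl x⟩
  by_cases hs : ∃ e : Quiver.Total V, e.left = x.range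
  · obtain ⟨e, he⟩ := hs
    obtain ⟨z, h1, -, h2⟩ := x.exists_snoc e he
    refine ⟨idem z, fun h => ?_, fun y hy => ?_⟩
    · rw [← h, map_mul, PartialTransformation.rel_mul] at hxx
      obtain ⟨b, -, hb⟩ := hxx
      obtain ⟨rfl, -, hb⟩ := (rep_idem _ _ _ _).1 hb
      simpa [h2] using hb.length_le
    · refine rep_true_injective (PartialTransformation.ext_rel fun u v => ?_)
      simp only [map_mul, PartialTransformation.rel_mul, rep_idem]
      constructor
      · rintro ⟨_, h, rfl, -⟩
        exact h
      · rintro ⟨_, ⟨rfl, hux⟩, rfl, huy⟩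
        refine ⟨u, ⟨u, ⟨rfl, hux⟩, rfl, huy⟩, rfl, ?_⟩
        -- Both `x` and `y` are initial segments of `u` and `y` is not one of `x`; so `y` properly
        -- extends `x`, necessarily along the unique edge `e`, and `u` extends `z`.
        have hyx := (hux.total huy).resolve_right hy
        obtain ⟨f, l, hf, hl⟩ := hyx.exists_edge fun h => hy (h ▸ .refl x)
        cases congrArg Subtype.val (Subsingleton.elim
          (⟨e, he⟩ : {e : Quiver.Total V // e.left = x.range}) ⟨f, hf⟩)
        exact huy.trans ⟨hyx.1.trans h1.symm, l, by simp [h2, hl]⟩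
  · refine ⟨mk 0, fun h => ?_, fun y hy => ?_⟩
    · rw [← h, mul_mk_zero] at hxx
      exact freeRep_zero (fun _ => True) _ _ hxx
    · rw [mul_mk_zero]
      refine rep_true_injective (PartialTransformation.ext_rel fun u v => ?_)
      simp only [map_mul, PartialTransformation.rel_mul, rep_idem]
      refine ⟨fun h => (freeRep_zero (fun _ => True) _ _ h).elim, ?_⟩
      rintro ⟨_, ⟨rfl, hux⟩, rfl, huy⟩
      -- A common extension `u` would make `y` extend `x` properly, but no edge leaves the range of
      -- `x`.
      obtain ⟨f, l, hf, hl⟩ :=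
        ((hux.total huy).resolve_right hy).exists_edge fun h => hy (h ▸ .refl x)
      exact (hs ⟨f, hf⟩).elim

end GraphInverseSemigroup

open GraphInverseSemigroup

theorem mainTheorem4 (V : Type u) [Quiver.{v} V] [Nonempty V]
    (hfin : Finite (GraphInverseSemigroup V)) :
    Finite {x : AllPaths V // outDegree x.range ≤ 1} ∧
      IsLeast (faithfulDegrees.{max u v, w} (GraphInverseSemigroup V))
        (Nat.card {x : AllPaths V // outDegree x.range ≤ 1} : Cardinal.{w}) := by
  have : Finite (AllPaths V) := Finite.of_injective _ idem_injective
  have hF : Finite {x : AllPaths V // outDegree x.range ≤ 1} := inferInstance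
  have equiv : {x : AllPaths V // outDegree x.range ≤ 1} ≃
      ULift.{w} (Fin (Nat.card {x : AllPaths V // outDegree x.range ≤ 1})) :=
    -- The degrees live in an arbitrary universe `w`, so the action is moved from the paths to a
    -- lifted `Fin`.
    (Finite.equivFin _).trans Equiv.ulift.symm
  have hcard : Cardinal.mk (ULift.{w} (Fin (Nat.card {x : AllPaths V // outDegree x.range ≤ 1}))) =
      Nat.card {x : AllPaths V // outDegree x.range ≤ 1} := by simp
  refine ⟨hF, ⟨_, ?_, hcard, (PartialTransformation.transport equiv).comp (rep (outDegree · ≤ 1)),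
    (PartialTransformation.transport_injective equiv).comp rep_outDegree_le_one_injective⟩, ?_⟩
  · obtain ⟨y, -, hy⟩ := (AllPaths.single (Classical.arbitrary V)).exists_extends_sink
    exact ⟨equiv ⟨y, Cardinal.le_one_iff_subsingleton.2 ⟨fun e => (hy e.1 e.2).elim⟩⟩⟩
  · rintro _ ⟨X, -, rfl, φ, hφ⟩
    choose m hm hm' using fun x : {x : AllPaths V // outDegree x.range ≤ 1} =>
      exists_lower_cover x.1 x.2
    obtain ⟨t, ht⟩ := exists_injective_of_faithful (fun x => idem x.1) m
      (fun x => idem_mul_self x.1) hm (fun x y hxy => by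
        -- Distinct paths cannot extend each other, so one of the two products lies strictly below
        -- the corresponding idempotent.
        by_cases h : x.1.Extends y.1
        · exact .inr (hm' y x fun h' => hxy (Subtype.ext (h'.antisymm h)))
        · exact .inl (hm' x y h)) φ hφ
    rw [← hcard]
    exact Cardinal.mk_le_of_injective (ht.comp equiv.symm.injective)
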